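/- Let $k=\mathbb{F}_q$ be a finite field with $q\equiv 2 \bmod 3$, and let $K_0\subset\mathbb{P}^8_{(z_0,\dots,z_8)}$ be the degree-14 K3 surface defined over $k$ by the seventeen equations $$ \begin{array}{l} z_5z_6 - z_4z_7 - z_2z_8 = z_3z_4 - z_1z_6 + z_2z_7 = z_0z_1 + z_3^2 + z_7z_8 = z_2z_4 - z_1z_5 + z_0z_7 = z_0z_5 + z_3z_7 + z_8^2 = 0,\\ z_2z_3 - z_4z_8 = z_0z_4 + z_3z_6 = z_0z_2 + z_6z_8 = z_2^2z_4z_6 - z_2^2z_5z_7 - z_4z_5^2z_8 + z_5^3z_8 - z_6z_7^2z_8 + z_7^3z_8 + z_8^4 = 0,\\ z_2^2z_5z_6 + z_2^2z_4z_7 - z_2^2z_5z_7 - z_4z_5^2z_8 - z_6z_7^2z_8 = z_4^2 - z_4z_5 + z_5^2 - z_0z_8 = z_1z_4 - z_2z_4 + z_2z_5 - z_0z_6 = 0,\\ z_6^2 - z_6z_7 + z_7^2 - z_3z_8 = z_4z_6 - z_4z_7 + z_5z_7 - z_1z_8 = z_3z_5 - z_2z_6 - z_1z_7 + z_2z_7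 = 0,\\ z_1^2 - z_1z_2 + z_2^2 - z_0z_3 = z_0^2 + z_1z_3 - z_4z_8 + z_5z_8 = 0. \end{array} $$ Then the number of $k$-rational points of $K_0$ is $$ \sharp K_0(k) = \frac{q^3-1}{q-1}-\frac{q^2-1}{q-1}+1 . $$ -/

import Mathlib

open scoped LinearAlgebra.Projectivization

/-- The `k`-rational points of the closed subscheme of `ℙⁿ` cut out by a family of polynomials `f`
in the homogeneous coordinates `z 0, …, z n`: the points of `ℙⁿ(k)` at whose coordinate vector all
`f i` vanish. For homogeneous `f i` the choice of the coordinate vector does not matter, see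
`mk_mem_projectiveZeros_iff`. -/
def projectiveZeros {k : Type*} [Field k] {n : ℕ} {ι : Type*}
    (f : ι → MvPolynomial (Fin (n + 1)) k) : Set (ℙ k (Fin (n + 1) → k)) :=
  {p | ∀ i, MvPolynomial.eval p.rep (f i) = 0}

theorem mk_mem_projectiveZeros_iff {k : Type*} [Field k] {n : ℕ} {ι : Type*}
    (f : ι → MvPolynomial (Fin (n + 1)) k) (d : ι → ℕ)
    (hf : ∀ i (a : k) (v : Fin (n + 1) → k),
      MvPolynomial.eval (a • v) (f i) = a ^ d i * MvPolynomial.eval v (f i))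
    (v : Fin (n + 1) → k) (hv : v ≠ 0) :
    Projectivization.mk k v hv ∈ projectiveZeros f ↔ ∀ i, MvPolynomial.eval v (f i) = 0 := by
  obtain ⟨a, ha⟩ := Projectivization.exists_smul_eq_mk_rep k v hv
  refine forall_congr' fun i => ?_
  rw [← ha, Units.smul_def, hf i]
  simp

namespace K0

open MvPolynomial

/-- The seventeen equations, in the homogeneous coordinates `z 0, …, z 8` of `ℙ⁸`, which define
the degree fourteen `K3` surface `K₀ ⊂ ℙ⁸`; they have integer coefficients. -/
noncomputable def equations (k : Type*) [CommRing k] : Fin 17 → MvPolynomial (Fin 9) k :=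
  ![X 5 * X 6 - X 4 * X 7 - X 2 * X 8,
    X 3 * X 4 - X 1 * X 6 + X 2 * X 7,
    X 0 * X 1 + X 3 ^ 2 + X 7 * X 8,
    X 2 * X 4 - X 1 * X 5 + X 0 * X 7,
    X 0 * X 5 + X 3 * X 7 + X 8 ^ 2,
    X 2 * X 3 - X 4 * X 8,
    X 0 * X 4 + X 3 * X 6,
    X 0 * X 2 + X 6 * X 8,
    X 2 ^ 2 * X 4 * X 6 - X 2 ^ 2 * X 5 * X 7 - X 4 * X 5 ^ 2 * X 8 + X 5 ^ 3 * X 8 - X 6 * X 7 ^ 2 * X 8 + X 7 ^ 3 * X 8 + X 8 ^ 4,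
    X 2 ^ 2 * X 5 * X 6 + X 2 ^ 2 * X 4 * X 7 - X 2 ^ 2 * X 5 * X 7 - X 4 * X 5 ^ 2 * X 8 - X 6 * X 7 ^ 2 * X 8,
    X 4 ^ 2 - X 4 * X 5 + X 5 ^ 2 - X 0 * X 8,
    X 1 * X 4 - X 2 * X 4 + X 2 * X 5 - X 0 * X 6,
    X 6 ^ 2 - X 6 * X 7 + X 7 ^ 2 - X 3 * X 8,
    X 4 * X 6 - X 4 * X 7 + X 5 * X 7 - X 1 * X 8,
    X 3 * X 5 - X 2 * X 6 - X 1 * X 7 + X 2 * X 7,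
    X 1 ^ 2 - X 1 * X 2 + X 2 ^ 2 - X 0 * X 3,
    X 0 ^ 2 + X 1 * X 3 - X 4 * X 8 + X 5 * X 8]

/-- The degrees of the equations of `K₀`. -/
def degrees : Fin 17 → ℕ :=
  ![2, 2, 2, 2, 2, 2, 2, 2, 4, 4, 2, 2, 2, 2, 2, 2, 2]

theorem eval_smul_equations (k : Type*) [Field k] (i : Fin 17) (a : k) (v : Fin 9 → k) :
    eval (a • v) (equations k i) = a ^ degrees i * eval v (equations k i) := by
  revert i
  simp only [Fin.forall_fin_succ, equations, degrees]
  simp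
  refine ⟨?_, ?_, ?_, ?_, ?_, ?_, ?_, ?_, ?_, ?_, ?_, ?_, ?_, ?_, ?_, ?_, ?_⟩ <;> ring

/-- The set `K₀(k)` of `k`-rational points of `K₀ ⊂ ℙ⁸`. -/
def points (k : Type*) [Field k] : Set (ℙ k (Fin 9 → k)) :=
  projectiveZeros (equations k)

theorem mk_mem_points_iff (k : Type*) [Field k] (v : Fin 9 → k) (hv : v ≠ 0) :
    Projectivization.mk k v hv ∈ points k ↔ ∀ i, eval v (equations k i) = 0 :=
  mk_mem_projectiveZeros_iff (equations k) degrees (eval_smul_equations k) v hv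

end K0

/-! For `q ≡ 2 [MOD 3]` cubing is a bijection of `k`, so `x ^ 2 - x * y + y ^ 2`, a factor of `x ^ 3
+ y ^ 3`, is anisotropic. Hence the hyperplane `z 8 = 0` contains a single point of `K₀`. On the
chart `z 8 = 1`, the pair `(z 6, z 7)` is a bijective coordinate onto `k × k`: `z 3` is its norm
form, `z 0 ^ 3` is a polynomial in the pair, and the remaining coordinates follow by dividing by `z
0`, or vanish with it. The total `q ^ 2 + 1` is the stated expression. -/

namespace K0

open MvPolynomial

theorem three_ne_zero_of_card {k : Type*} [Field k] (hq : Nat.card k ≡ 2 [MOD 3]) : (3 : k) ≠ 0 := by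
  intro h
  have h3 : addOrderOf (1 : k) = 3 :=
    addOrderOf_eq_prime (by simpa using h) one_ne_zero
  have h4 : 3 ∣ Nat.card k := h3 ▸ addOrderOf_dvd_natCard (1 : k)
  have h2 : Nat.card k % 3 = 2 := hq
  omega

section FiniteField

variable {k : Type*} [Field k] [Finite k]

theorem exists_cube_pow_eq_self (hq : Nat.card k ≡ 2 [MOD 3]) :
    ∃ m : ℕ, ∀ x : k, (x ^ 3) ^ m = x := by
  have := Fintype.ofFinite k
  rw [Nat.card_eq_fintype_card] at hq
  have h2 : Fintype.card k % 3 = 2 := hq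
  -- With this exponent `3 * m = 2 * q - 1 = (q - 1) + q`, and `x ^ q = x` is applied twice.
  refine ⟨(2 * Fintype.card k - 1) / 3, fun x => ?_⟩
  rw [← pow_mul, show 3 * ((2 * Fintype.card k - 1) / 3)
    = (Fintype.card k - 1) + Fintype.card k by omega, pow_add, FiniteField.pow_card,
    ← pow_succ, show Fintype.card k - 1 + 1 = Fintype.card k by omega, FiniteField.pow_card]

theorem cube_injective (hq : Nat.card k ≡ 2 [MOD 3]) :
    Function.Injective fun x : k => x ^ 3 := by
  obtain ⟨m, hm⟩ := exists_cube_pow_eq_self hq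
  intro x y h
  rw [← hm x, ← hm y]
  exact congrArg (· ^ m) h

theorem cube_surjective (hq : Nat.card k ≡ 2 [MOD 3]) :
    Function.Surjective fun x : k => x ^ 3 :=
  Finite.surjective_of_injective (cube_injective hq)

/-- The norm form `x ^ 2 - x * y + y ^ 2` is anisotropic over `k`. -/
theorem eq_zero_of_norm_eq_zero (hq : Nat.card k ≡ 2 [MOD 3]) {x y : k}
    (h : x ^ 2 - x * y + y ^ 2 = 0) : x = 0 ∧ y = 0 := by
  have hxy : x = -y := cube_injective hq (by
    simp only
    linear_combination (x + y) * h)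
  subst hxy
  have hy : (3 : k) * y ^ 2 = 0 := by linear_combination h
  have : y = 0 := by simpa [three_ne_zero_of_card hq] using hy
  simp [this]

end FiniteField

theorem eval_equations_eq_zero_iff {k : Type*} [Field k] (v : Fin 9 → k) :
    (∀ i, eval v (equations k i) = 0) ↔
      v 5 * v 6 - v 4 * v 7 - v 2 * v 8 = 0 ∧
      v 3 * v 4 - v 1 * v 6 + v 2 * v 7 = 0 ∧
      v 0 * v 1 + v 3 ^ 2 + v 7 * v 8 = 0 ∧
      v 2 * v 4 - v 1 * v 5 + v 0 * v 7 = 0 ∧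
      v 0 * v 5 + v 3 * v 7 + v 8 ^ 2 = 0 ∧
      v 2 * v 3 - v 4 * v 8 = 0 ∧
      v 0 * v 4 + v 3 * v 6 = 0 ∧
      v 0 * v 2 + v 6 * v 8 = 0 ∧
      v 2 ^ 2 * v 4 * v 6 - v 2 ^ 2 * v 5 * v 7 - v 4 * v 5 ^ 2 * v 8 + v 5 ^ 3 * v 8
        - v 6 * v 7 ^ 2 * v 8 + v 7 ^ 3 * v 8 + v 8 ^ 4 = 0 ∧
      v 2 ^ 2 * v 5 * v 6 + v 2 ^ 2 * v 4 * v 7 - v 2 ^ 2 * v 5 * v 7 - v 4 * v 5 ^ 2 * v 8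
        - v 6 * v 7 ^ 2 * v 8 = 0 ∧
      v 4 ^ 2 - v 4 * v 5 + v 5 ^ 2 - v 0 * v 8 = 0 ∧
      v 1 * v 4 - v 2 * v 4 + v 2 * v 5 - v 0 * v 6 = 0 ∧
      v 6 ^ 2 - v 6 * v 7 + v 7 ^ 2 - v 3 * v 8 = 0 ∧
      v 4 * v 6 - v 4 * v 7 + v 5 * v 7 - v 1 * v 8 = 0 ∧
      v 3 * v 5 - v 2 * v 6 - v 1 * v 7 + v 2 * v 7 = 0 ∧
      v 1 ^ 2 - v 1 * v 2 + v 2 ^ 2 - v 0 * v 3 = 0 ∧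
      v 0 ^ 2 + v 1 * v 3 - v 4 * v 8 + v 5 * v 8 = 0 := by
  simp [Fin.forall_fin_succ, equations]

section Points

variable {k : Type*} [Field k] [Finite k]

/-- The solutions of the equations with `z 8 = 0` form the cone over a single point. -/
theorem eq_smul_of_eval_equations_eq_zero (hq : Nat.card k ≡ 2 [MOD 3]) {v : Fin 9 → k}
    (hv : ∀ i, eval v (equations k i) = 0) (h8 : v 8 = 0) :
    v = v 0 • ![1, -1, 0, 1, 0, 0, 0, 0, 0] := by
  obtain ⟨-, -, h3, -, -, -, -, h8', -, -, h11, -, h13, -, -, h16, h17⟩ :=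
    (eval_equations_eq_zero_iff v).1 hv
  simp only [h8, mul_zero, sub_zero, add_zero] at h3 h8' h11 h13 h17
  obtain ⟨h4, h5⟩ := eq_zero_of_norm_eq_zero hq h11
  obtain ⟨h6, h7⟩ := eq_zero_of_norm_eq_zero hq h13
  have hb : v 3 = v 0 := cube_injective hq (by
    simp only
    linear_combination v 3 * h3 - v 0 * h17)
  rw [hb] at h3 h16
  have h12 : v 1 = - v 0 ∧ v 2 = 0 := by
    by_cases h0 : v 0 = 0
    · simpa [h0] using eq_zero_of_norm_eq_zero hq (x := v 1) (y := v 2) (by simpa [h0] using h16)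
    · exact ⟨mul_left_cancel₀ h0 (by linear_combination h3), by simpa [h0] using h8'⟩
  ext i
  fin_cases i <;> simp [*]

/-- A solution of the equations with `z 8 = 1` is determined by `z 6` and `z 7`. -/
theorem eq_of_eval_equations_eq_zero (hq : Nat.card k ≡ 2 [MOD 3]) {v w : Fin 9 → k}
    (hv : ∀ i, eval v (equations k i) = 0) (hw : ∀ i, eval w (equations k i) = 0)
    (hv8 : v 8 = 1) (hw8 : w 8 = 1) (e6 : v 6 = w 6) (e7 : v 7 = w 7) : v = w := by
  obtain ⟨-, -, v3, -, v5, -, v7, v8, -, -, v11, -, v13, -, -, v16, v17⟩ :=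
    (eval_equations_eq_zero_iff v).1 hv
  obtain ⟨-, -, w3, -, w5, -, w7, w8, -, -, w11, -, w13, -, -, w16, w17⟩ :=
    (eval_equations_eq_zero_iff w).1 hw
  rw [hv8] at v3 v5 v8 v11 v13 v17
  rw [hw8] at w3 w5 w8 w11 w13 w17
  rw [e6] at v7 v8 v13
  rw [e7] at v3 v5 v13
  have e3 : v 3 = w 3 := by linear_combination w13 - v13
  rw [e3] at v3 v5 v7 v16 v17
  have e0 : v 0 = w 0 := cube_injective hq (by
    simp only
    -- Both cubes equal `b ^ 3 + 1 + b * (2 * y - x)` with `b = z 3`, `x = z 6`, `y = z 7`: multiply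
    -- the last equation by `z 0` and eliminate `z 0 * z 1`, `z 0 * z 4`, `z 0 * z 5`.
    linear_combination v 0 * v17 - w 0 * w17 - w 3 * (v3 - w3) - (v5 - w5) + (v7 - w7))
  rw [e0] at v3 v5 v7 v8 v11 v16
  by_cases h0 : w 0 = 0
  · simp only [h0, zero_mul, sub_zero] at v11 w11 v16 w16
    obtain ⟨a1, a2⟩ := eq_zero_of_norm_eq_zero hq v16
    obtain ⟨b1, b2⟩ := eq_zero_of_norm_eq_zero hq w16
    obtain ⟨a4, a5⟩ := eq_zero_of_norm_eq_zero hq v11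
    obtain ⟨b4, b5⟩ := eq_zero_of_norm_eq_zero hq w11
    ext i
    fin_cases i <;> simp [*]
  · have e1 : v 1 = w 1 := mul_left_cancel₀ h0 (by linear_combination v3 - w3)
    have e2 : v 2 = w 2 := mul_left_cancel₀ h0 (by linear_combination v8 - w8)
    have e4 : v 4 = w 4 := mul_left_cancel₀ h0 (by linear_combination v7 - w7)
    have e5 : v 5 = w 5 := mul_left_cancel₀ h0 (by linear_combination v5 - w5)
    ext i
    fin_cases i <;> simp [*]

/-- For all `x` and `y` there is a solution of the equations with `z 6 = x`, `z 7 = y` and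
`z 8 = 1`. -/
theorem exists_eval_equations_eq_zero (hq : Nat.card k ≡ 2 [MOD 3]) (x y : k) :
    ∃ v : Fin 9 → k, v 6 = x ∧ v 7 = y ∧ v 8 = 1 ∧ ∀ i, eval v (equations k i) = 0 := by
  obtain ⟨b, hb⟩ : ∃ b, b = x ^ 2 - x * y + y ^ 2 := ⟨_, rfl⟩
  obtain ⟨a, ha⟩ := cube_surjective hq (b ^ 3 + 1 + b * (2 * y - x))
  simp only at ha
  by_cases h0 : a = 0
  · subst h0
    -- The norm form at `(1 + b * y, b * x)` equals `a ^ 3`, so `a = 0` forces both entries to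
    -- vanish.
    obtain ⟨hb5, hbx⟩ := eq_zero_of_norm_eq_zero hq (x := 1 + b * y) (y := b * x) (by
      linear_combination (-b ^ 2) * hb - ha)
    have hb0 : b ≠ 0 := by
      rintro rfl
      simp at hb5
    obtain rfl : x = 0 := by simpa [hb0] using hbx
    have hb1 : b ^ 2 + y = 0 := mul_left_cancel₀ hb0 (by linear_combination -ha - hb5)
    refine ⟨![0, 0, 0, b, 0, 0, 0, y, 1], rfl, rfl, rfl, ?_⟩
    rw [eval_equations_eq_zero_iff]
    simp only [Matrix.cons_val]
    refine ⟨?_, ?_, ?_, ?_, ?_, ?_, ?_, ?_, ?_, ?_, ?_, ?_, ?_, ?_, ?_, ?_, ?_⟩ <;> grind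
  -- The quotients solve the four equations linear in `z 1`, `z 2`, `z 4`, `z 5` with coefficient `z
  -- 0 = a`.
  · refine ⟨![a, (-b ^ 2 - y) / a, -x / a, b, -b * x / a, (-1 - b * y) / a, x, y, 1],
      rfl, rfl, rfl, ?_⟩
    rw [eval_equations_eq_zero_iff]
    simp only [Matrix.cons_val]
    refine ⟨?_, ?_, ?_, ?_, ?_, ?_, ?_, ?_, ?_, ?_, ?_, ?_, ?_, ?_, ?_, ?_, ?_⟩ <;>
    field_simp <;> grind

theorem card_points (hq : Nat.card k ≡ 2 [MOD 3]) :
    Nat.card (points k) = Nat.card k ^ 2 + 1 := by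
  have hinf : (![1, -1, 0, 1, 0, 0, 0, 0, 0] : Fin 9 → k) ≠ 0 := fun h => by
    simpa using congrFun h 0
  have hinf' : ∀ i, eval (![1, -1, 0, 1, 0, 0, 0, 0, 0] : Fin 9 → k) (equations k i) = 0 := by
    rw [eval_equations_eq_zero_iff]
    simp
  choose s hs6 hs7 hs8 hs using exists_eval_equations_eq_zero (k := k) hq
  have hs0 : ∀ x y, s x y ≠ 0 := fun x y h => by simpa [h] using hs8 x y
  let f : Option (k × k) → points k := fun o => o.elim
    ⟨Projectivization.mk k _ hinf, (mk_mem_points_iff k _ hinf).2 hinf'⟩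
    (fun p => ⟨Projectivization.mk k _ (hs0 p.1 p.2), (mk_mem_points_iff k _ _).2 (hs p.1 p.2)⟩)
  have hf : Function.Bijective f := by
    constructor
    · rintro (_ | ⟨x, y⟩) (_ | ⟨x', y'⟩) h
      · rfl
      · obtain ⟨a, ha⟩ := (Projectivization.mk_eq_mk_iff' k _ _ _ _).1 (congrArg Subtype.val h)
        have h8 := congrFun ha 8
        have h0 := congrFun ha 0
        simp [hs8] at h8
        simp [h8] at h0
      · obtain ⟨a, ha⟩ := (Projectivization.mk_eq_mk_iff' k _ _ _ _).1 (congrArg Subtype.val h)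
        have h8 := congrFun ha 8
        simp [hs8] at h8
      · obtain ⟨a, ha⟩ := (Projectivization.mk_eq_mk_iff' k _ _ _ _).1 (congrArg Subtype.val h)
        have h8 := congrFun ha 8
        have h7 := congrFun ha 7
        have h6 := congrFun ha 6
        simp only [Pi.smul_apply, smul_eq_mul, hs6, hs7, hs8, mul_one] at h6 h7 h8
        simp [← h6, ← h7, h8]
    · rintro ⟨p, hp⟩
      induction p using Projectivization.ind with
      | h v hv0 =>
        have hv := (mk_mem_points_iff k v hv0).1 hp
        by_cases h8 : v 8 = 0
        · refine ⟨none, Subtype.ext ?_⟩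
          have e := eq_smul_of_eval_equations_eq_zero hq hv h8
          have h0 : v 0 ≠ 0 := fun h0 => hv0 (by rw [e, h0, zero_smul])
          refine (Projectivization.mk_eq_mk_iff' k _ _ _ _).2 ⟨(v 0)⁻¹, ?_⟩
          rw [inv_smul_eq_iff₀ h0]
          exact e
        · refine ⟨some (v 6 / v 8, v 7 / v 8), Subtype.ext ?_⟩
          refine (Projectivization.mk_eq_mk_iff' k _ _ _ _).2 ⟨(v 8)⁻¹, ?_⟩
          refine eq_of_eval_equations_eq_zero hq (fun i => ?_) (hs _ _) (by simp [h8])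
            (hs8 _ _) ?_ ?_
          · rw [eval_smul_equations, hv, mul_zero]
          · simp [hs6, div_eq_inv_mul]
          · simp [hs7, div_eq_inv_mul]
  rw [← Nat.card_congr (Equiv.ofBijective f hf), Finite.card_option, Nat.card_prod, sq]

end Points

end K0

theorem corollary7p7 (k : Type*) [Field k] [Finite k] (q : ℕ) (hk : Nat.card k = q)
    (hq : q ≡ 2 [MOD 3]) :
    (Nat.card (K0.points k) : ℚ)
      = ((q : ℚ) ^ 3 - 1) / ((q : ℚ) - 1) - ((q : ℚ) ^ 2 - 1) / ((q : ℚ) - 1) + 1 := by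
  subst hk
  have h1 : (Nat.card k : ℚ) - 1 ≠ 0 :=
    sub_ne_zero.2 (by exact_mod_cast (Finite.one_lt_card (α := k)).ne')
  rw [K0.card_points hq]
  field_simp
  push_cast
  ring
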